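/- Let $0<r<1$ and $k=\sqrt{1-r^2}$. Let $F(\varphi,k)=\int_0^{\varphi}\frac{dt}{\sqrt{1-k^2\sin^2 t}}$ for $\varphi\in\mathbb{R}$, let $K(k)=F(\pi/2,k)$ be the complete elliptic integral of the first kind with modulus $k$, and let $\mathrm{dn}(v,k)=\sqrt{1-k^2\sin^2\mathrm{am}(v,k)}$ be Jacobi's delta amplitude for $v\in\mathbb{R}$, where $\mathrm{am}(\cdot,k)$ is the inverse function of $F(\cdot,k)$. Put $$\Phi_r(u)=\mathrm{dn}\!\left(\frac{K(k)\arccos u}{\pi},\,k\right),\qquad -1\le u\le 1,$$ and for every integer $n\ge 0$ $$\widetilde\Phi_{r,n}(z)=\frac1\pi\int_0^\pi e^{-z\,\Phi_r(\cos\theta)}\cos(n\theta)\,d\theta,\qquad z\in\mathbb{C}.$$ Let $\mathcal{D}_r$ be the fourth order differential operator $$\mathcal{D}_r = z^2\frac{d^4}{dz^4}+2z\frac{d^3}{dz^3}-(1+r^2)z^2\frac{d^2}{dz^2}-(1+r^2)z\frac{d}{dz}+r^2z^2 .$$ Then, as operators on functions analytic at $z\in\mathbb{C}$, $$\mathcal{D}_r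 = z\left(\frac{d^2}{dz^2}\,z\,\frac{d^2}{dz^2}-\frac{d}{dz}\,(1+r^2)z\,\frac{d}{dz}+r^2z\right),$$ and for every integer $n\ge 0$ the function $\widetilde\Phi_{r,n}$ is entire, is not identically zero, and satisfies $$\mathcal{D}_r\widetilde\Phi_{r,n}(z)=\frac{n^2\pi^2}{K(k)^2}\,\widetilde\Phi_{r,n}(z)\qquad\text{for all } z\in\mathbb{C}.$$ -/

import Mathlib

/-- Incomplete elliptic integral of the first kind with modulus `k`,
`F(φ, k) = ∫₀^φ dt / √(1 - k² sin² t)`. -/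
noncomputable def ellipticF (φ k : ℝ) : ℝ :=
  ∫ t in (0 : ℝ)..φ, 1 / √(1 - k ^ 2 * Real.sin t ^ 2)

/-- Complete elliptic integral of the first kind with modulus `k`. -/
noncomputable def ellipticK (k : ℝ) : ℝ :=
  ellipticF (Real.pi / 2) k

/-- Jacobi's amplitude function `am(·, k)` on the real line: the inverse of `φ ↦ F(φ, k)`,
which is a bijection of the real line when `k ^ 2 < 1`
(see `ellipticF_jacobiAm` and `jacobiAm_ellipticF`). -/
noncomputable def jacobiAm (v k : ℝ) : ℝ :=
  Function.invFun (fun φ : ℝ => ellipticF φ k) v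

/-- Jacobi's delta amplitude `dn(v, k) = √(1 - k² sin² am(v, k))` on the real line. -/
noncomputable def jacobiDn (v k : ℝ) : ℝ :=
  √(1 - k ^ 2 * Real.sin (jacobiAm v k) ^ 2)

/-- The modulus `k = √(1 - r²)`. -/
noncomputable def modulus (r : ℝ) : ℝ :=
  √(1 - r ^ 2)

/-- The variable transformation `Φ_r(u) = dn(K(k) arccos u / π, k)`, `k = √(1 - r²)`,
for `-1 ≤ u ≤ 1`. -/
noncomputable def PhiTransform (r u : ℝ) : ℝ :=
  jacobiDn (ellipticK (modulus r) * Real.arccos u / Real.pi) (modulus r)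

/-- The basis functions attached to a variable transformation `ϑ` on `[-1, 1]`:
`z ↦ (1/π) ∫₀^π exp(-z ϑ(cos θ)) cos(n θ) dθ`. -/
noncomputable def basisFunction (ϑ : ℝ → ℝ) (n : ℕ) (z : ℂ) : ℂ :=
  1 / (Real.pi : ℂ) * ∫ θ in (0 : ℝ)..Real.pi,
    Complex.exp (-z * (ϑ (Real.cos θ) : ℂ)) * (Real.cos (n * θ) : ℂ)

/-- The operator
`z² d⁴/dz⁴ + 2z d³/dz³ - (1 + r²) z² d²/dz² - (1 + r²) z d/dz + r² z²`
acting on functions of a complex variable. -/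
noncomputable def operatorD (r : ℝ) (f : ℂ → ℂ) (z : ℂ) : ℂ :=
  z ^ 2 * iteratedDeriv 4 f z + 2 * z * iteratedDeriv 3 f z
    - (1 + (r : ℂ) ^ 2) * z ^ 2 * iteratedDeriv 2 f z
    - (1 + (r : ℂ) ^ 2) * z * deriv f z + (r : ℂ) ^ 2 * z ^ 2 * f z

/-- The operator `z (d²/dz² z d²/dz² - d/dz (1 + r²) z d/dz + r² z)`
acting on functions of a complex variable. -/
noncomputable def operatorDFactored (r : ℝ) (f : ℂ → ℂ) (z : ℂ) : ℂ :=
  z * (iteratedDeriv 2 (fun w => w * iteratedDeriv 2 f w) z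
    - deriv (fun w => (1 + (r : ℂ) ^ 2) * w * deriv f w) z + (r : ℂ) ^ 2 * z * f z)

theorem ellipticF_integrand_pos {k : ℝ} (hk : k ^ 2 < 1) (t : ℝ) :
    0 < 1 - k ^ 2 * Real.sin t ^ 2 := by
  nlinarith [Real.sin_sq_le_one t, sq_nonneg k, sq_nonneg (Real.sin t)]

theorem ellipticF_integrand_continuous {k : ℝ} (hk : k ^ 2 < 1) :
    Continuous fun t : ℝ => 1 / √(1 - k ^ 2 * Real.sin t ^ 2) := by
  refine continuous_const.div (by fun_prop) fun t => ?_
  exact (Real.sqrt_pos.2 (ellipticF_integrand_pos hk t)).ne'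

theorem ellipticF_sub_ge {k : ℝ} (hk : k ^ 2 < 1) {a b : ℝ} (hab : a ≤ b) :
    b - a ≤ ellipticF b k - ellipticF a k := by
  have hc := ellipticF_integrand_continuous hk
  unfold ellipticF
  rw [intervalIntegral.integral_interval_sub_left (hc.intervalIntegrable _ _)
    (hc.intervalIntegrable _ _)]
  have h := intervalIntegral.integral_mono_on
    (μ := MeasureTheory.volume) (f := fun _ : ℝ => (1 : ℝ)) hab
    (continuous_const.intervalIntegrable _ _) (hc.intervalIntegrable a b)
    (fun t _ => by
      have hp := Real.sqrt_pos.2 (ellipticF_integrand_pos hk t)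
      rw [le_div_iff₀ hp, one_mul]
      refine Real.sqrt_le_one.2 ?_
      nlinarith [mul_nonneg (sq_nonneg k) (sq_nonneg (Real.sin t))])
  simpa using h

theorem ellipticF_bijective {k : ℝ} (hk : k ^ 2 < 1) :
    Function.Bijective fun φ : ℝ => ellipticF φ k := by
  have hc := ellipticF_integrand_continuous hk
  have h0 : ellipticF 0 k = 0 := by simp [ellipticF]
  constructor
  · refine StrictMono.injective fun a b hab => ?_
    have := ellipticF_sub_ge hk hab.le
    show ellipticF a k < ellipticF b k
    linarith
  · refine Continuous.surjective ?_ ?_ ?_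
    · exact intervalIntegral.continuous_primitive (fun a b => hc.intervalIntegrable a b) 0
    · refine Filter.tendsto_atTop_mono' _ ?_ Filter.tendsto_id
      filter_upwards [Filter.eventually_ge_atTop 0] with x hx
      have := ellipticF_sub_ge hk hx
      simp only [id]
      linarith
    · refine Filter.tendsto_atBot_mono' _ ?_ Filter.tendsto_id
      filter_upwards [Filter.eventually_le_atBot 0] with x hx
      have := ellipticF_sub_ge hk hx
      simp only [id]
      linarith

theorem ellipticF_jacobiAm {k : ℝ} (hk : k ^ 2 < 1) (v : ℝ) :
    ellipticF (jacobiAm v k) k = v :=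
  Function.invFun_eq (f := fun φ : ℝ => ellipticF φ k) ((ellipticF_bijective hk).2 v)

theorem jacobiAm_ellipticF {k : ℝ} (hk : k ^ 2 < 1) (φ : ℝ) :
    jacobiAm (ellipticF φ k) k = φ :=
  Function.leftInverse_invFun (f := fun φ : ℝ => ellipticF φ k) (ellipticF_bijective hk).1 φ

open MeasureTheory Set

/-! Put `c = K/π` and `g θ = dn (c θ)`, so that `Φ_r (cos θ) = g θ` on `[0, π]`. Each `d/dz` brings
down a factor `-g`, hence `D_r` multiplies the kernel `exp (-z g)` by a polynomial in `z` and `g`.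
Since `dn'² = (1 - dn²)(dn² - r²)` and `dn'' = (1 + r²) dn - 2 dn³`, that product is exactly `-c⁻²
∂²/∂θ²` of the kernel. Integrating by parts twice against `cos (n θ)` gives the eigenvalue `n²/c²`;
the boundary terms vanish because `dn'` is zero at `0` and `K` (`integral_mul_cos_of_neumann`).

For nonvanishing, the derivatives at `z = 0` are, up to constant factors, the moments `∫ g^j cos (n
θ)`. As `g` is injective on `[0, π]`, Stone–Weierstrass shows they cannot all vanish
(`eqOn_zero_of_integral_pow_mul_eq_zero`). -/

theorem modulus_sq {r : ℝ} (hr0 : 0 < r) (hr1 : r < 1) : modulus r ^ 2 = 1 - r ^ 2 := by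
  rw [modulus, Real.sq_sqrt]
  nlinarith

/-! ### The factored form of the operator -/

theorem operatorD_eq_operatorDFactored (r : ℝ) {f : ℂ → ℂ} {z : ℂ} (hf : AnalyticAt ℂ f z) :
    operatorD r f z = operatorDFactored r f z := by
  have hs (g : ℂ → ℂ) (j : ℕ) : deriv (iteratedDeriv j g) = iteratedDeriv (j + 1) g :=
    iteratedDeriv_succ.symm
  have ha (j : ℕ) {w : ℂ} (hw : AnalyticAt ℂ f w) :
      HasDerivAt (iteratedDeriv j f) (iteratedDeriv (j + 1) f w) w := by
    rw [← hs]
    have h := hw.iterated_deriv j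
    rw [← iteratedDeriv_eq_iterate] at h
    exact h.differentiableAt.hasDerivAt
  -- Needed on a neighbourhood of `z`, not only at `z`, because it is differentiated once more.
  have h1 : deriv (fun w => w * iteratedDeriv 2 f w)
      =ᶠ[nhds z] fun w => iteratedDeriv 2 f w + w * iteratedDeriv 3 f w := by
    filter_upwards [hf.eventually_analyticAt] with w hw
    have := ((hasDerivAt_id w).mul (ha 2 hw)).deriv
    simp only [id, one_mul] at this
    exact this
  have h2 : iteratedDeriv 2 (fun w => w * iteratedDeriv 2 f w) z
      = 2 * iteratedDeriv 3 f z + z * iteratedDeriv 4 f z := by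
    rw [iteratedDeriv_succ, iteratedDeriv_one, h1.deriv_eq]
    have := ((ha 2 hf).add ((hasDerivAt_id z).mul (ha 3 hf))).deriv
    simp only [id, one_mul] at this
    refine Eq.trans this ?_
    ring
  have h3 : deriv (fun w => (1 + (r : ℂ) ^ 2) * w * deriv f w) z
      = (1 + (r : ℂ) ^ 2) * (deriv f z + z * iteratedDeriv 2 f z) := by
    have h := ha 1 hf
    rw [iteratedDeriv_one] at h
    have := (((hasDerivAt_id z).const_mul (1 + (r : ℂ) ^ 2)).mul h).deriv
    simp only [id, mul_one] at this
    refine Eq.trans this ?_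
    ring
  rw [operatorD, operatorDFactored, h2, h3]
  ring

/-! ### Derivatives of Jacobi's elliptic functions on the real line -/

theorem hasDerivAt_ellipticF {k : ℝ} (hk : k ^ 2 < 1) (φ : ℝ) :
    HasDerivAt (fun φ => ellipticF φ k) (1 / √(1 - k ^ 2 * Real.sin φ ^ 2)) φ := by
  have hc := ellipticF_integrand_continuous hk
  exact intervalIntegral.integral_hasDerivAt_right (hc.intervalIntegrable _ _)
    (hc.stronglyMeasurableAtFilter _ _) hc.continuousAt

theorem jacobiAm_monotone {k : ℝ} (hk : k ^ 2 < 1) : Monotone fun v => jacobiAm v k := by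
  intro a b hab
  by_contra! h
  have := ellipticF_sub_ge hk h.le
  rw [ellipticF_jacobiAm hk, ellipticF_jacobiAm hk] at this
  linarith

theorem continuous_jacobiAm {k : ℝ} (hk : k ^ 2 < 1) : Continuous fun v => jacobiAm v k :=
  (jacobiAm_monotone hk).continuous_of_surjective fun φ => ⟨_, jacobiAm_ellipticF hk φ⟩

theorem hasDerivAt_jacobiAm {k : ℝ} (hk : k ^ 2 < 1) (v : ℝ) :
    HasDerivAt (fun v => jacobiAm v k) (jacobiDn v k) v := by
  have hp := Real.sqrt_pos.2 (ellipticF_integrand_pos hk (jacobiAm v k))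
  have := (hasDerivAt_ellipticF hk (jacobiAm v k)).of_local_left_inverse
    (continuous_jacobiAm hk).continuousAt (by positivity)
    (Filter.Eventually.of_forall fun y => ellipticF_jacobiAm hk y)
  simpa [jacobiDn] using this

theorem jacobiDn_sq {k : ℝ} (hk : k ^ 2 < 1) (v : ℝ) :
    jacobiDn v k ^ 2 = 1 - k ^ 2 * Real.sin (jacobiAm v k) ^ 2 :=
  Real.sq_sqrt (ellipticF_integrand_pos hk _).le

theorem jacobiDn_pos {k : ℝ} (hk : k ^ 2 < 1) (v : ℝ) : 0 < jacobiDn v k :=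
  Real.sqrt_pos.2 (ellipticF_integrand_pos hk _)

theorem hasDerivAt_jacobiDn {k : ℝ} (hk : k ^ 2 < 1) (v : ℝ) :
    HasDerivAt (fun v => jacobiDn v k)
      (-k ^ 2 * (Real.sin (jacobiAm v k) * Real.cos (jacobiAm v k))) v := by
  have h := (((((hasDerivAt_jacobiAm hk v).sin).pow 2).const_mul (k ^ 2)).const_sub 1).sqrt
    (ellipticF_integrand_pos hk _).ne'
  have hp := jacobiDn_pos hk v
  refine h.congr_deriv ?_
  change _ / (2 * jacobiDn v k) = _
  field_simp
  simp
  ring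

/-- The function differentiated is `dn'`, so this is the second order equation of `dn`; `sin²` and
`cos²` are eliminated through `dn² = 1 - k² sin²`. -/
theorem hasDerivAt_sin_mul_cos_jacobiAm {k : ℝ} (hk : k ^ 2 < 1) (v : ℝ) :
    HasDerivAt (fun v => -k ^ 2 * (Real.sin (jacobiAm v k) * Real.cos (jacobiAm v k)))
      ((2 - k ^ 2) * jacobiDn v k - 2 * jacobiDn v k ^ 3) v := by
  have h := ((hasDerivAt_jacobiAm hk v).sin.mul (hasDerivAt_jacobiAm hk v).cos).const_mul (-k ^ 2)
  refine h.congr_deriv ?_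
  have h3 := jacobiDn_sq hk v
  have h4 := Real.sin_sq_add_cos_sq (jacobiAm v k)
  linear_combination (-k ^ 2 * jacobiDn v k) * h4 + 2 * jacobiDn v k * h3

theorem jacobiAm_zero {k : ℝ} (hk : k ^ 2 < 1) : jacobiAm 0 k = 0 := by
  have := jacobiAm_ellipticF hk 0
  rwa [show ellipticF 0 k = 0 by simp [ellipticF]] at this

theorem jacobiAm_ellipticK {k : ℝ} (hk : k ^ 2 < 1) : jacobiAm (ellipticK k) k = Real.pi / 2 :=
  jacobiAm_ellipticF hk _

theorem ellipticK_pos {k : ℝ} (hk : k ^ 2 < 1) : 0 < ellipticK k := by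
  have := ellipticF_sub_ge hk (a := 0) (b := Real.pi / 2) (by positivity)
  rw [show ellipticF 0 k = 0 by simp [ellipticF]] at this
  have := Real.pi_pos
  rw [ellipticK]
  linarith

/-- On `[0, K]` the amplitude stays in `[0, π/2]`, where `sin` is nonnegative and injective; `k ≠ 0`
lets `dn²` determine `sin²`. -/
theorem jacobiDn_injOn {k : ℝ} (hk0 : k ≠ 0) (hk : k ^ 2 < 1) :
    InjOn (fun v => jacobiDn v k) (Icc 0 (ellipticK k)) := by
  have hmem {v : ℝ} (hv : v ∈ Icc 0 (ellipticK k)) : jacobiAm v k ∈ Icc 0 (Real.pi / 2) := by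
    rw [← jacobiAm_zero hk, ← jacobiAm_ellipticK hk]
    exact ⟨jacobiAm_monotone hk hv.1, jacobiAm_monotone hk hv.2⟩
  intro a ha b hb hab
  have hab : jacobiDn a k = jacobiDn b k := hab
  have ha := hmem ha
  have hb := hmem hb
  have hsq : k ^ 2 * Real.sin (jacobiAm a k) ^ 2 = k ^ 2 * Real.sin (jacobiAm b k) ^ 2 := by
    have h := jacobiDn_sq hk a
    rw [hab, jacobiDn_sq hk b] at h
    linarith
  have hsin : Real.sin (jacobiAm a k) = Real.sin (jacobiAm b k) := by
    have hpi := Real.pi_pos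
    refine (sq_eq_sq₀ ?_ ?_).1 (mul_left_cancel₀ (pow_ne_zero 2 hk0) hsq)
    · exact Real.sin_nonneg_of_nonneg_of_le_pi ha.1 (by linarith [ha.2])
    · exact Real.sin_nonneg_of_nonneg_of_le_pi hb.1 (by linarith [hb.2])
  have ham := Real.injOn_sin ⟨by linarith [ha.1, Real.pi_pos], ha.2⟩
    ⟨by linarith [hb.1, Real.pi_pos], hb.2⟩ hsin
  rw [← ellipticF_jacobiAm hk a, ham, ellipticF_jacobiAm hk b]

/-! ### Exponential integrals depending on a complex parameter -/

theorem hasDerivAt_integral_mul_exp {g : ℝ → ℝ} {h : ℝ → ℂ} (hg : Continuous g)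
    (hh : Continuous h) (a b : ℝ) (z : ℂ) :
    HasDerivAt (fun z : ℂ => ∫ θ in a..b, Complex.exp (-z * (g θ : ℂ)) * h θ)
      (∫ θ in a..b, Complex.exp (-z * (g θ : ℂ)) * (-(g θ : ℂ) * h θ)) z := by
  have hgc : Continuous fun θ => (g θ : ℂ) := Complex.continuous_ofReal.comp hg
  refine (intervalIntegral.hasDerivAt_integral_of_dominated_loc_of_deriv_le
    (F' := fun w θ => Complex.exp (-w * (g θ : ℂ)) * (-(g θ : ℂ) * h θ))
    -- On the unit ball around `z`, `‖w‖ ≤ ‖z‖ + 1`.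
    (bound := fun θ => Real.exp ((‖z‖ + 1) * |g θ|) * ‖-(g θ : ℂ) * h θ‖)
    (Metric.ball_mem_nhds z one_pos) ?_ ?_ ?_ ?_ ?_ ?_).2
  · exact Filter.Eventually.of_forall fun w => Continuous.aestronglyMeasurable (by fun_prop)
  · exact Continuous.intervalIntegrable (by fun_prop) _ _
  · exact Continuous.aestronglyMeasurable (by fun_prop)
  · refine Filter.Eventually.of_forall fun θ _ w hw => ?_
    rw [norm_mul, Complex.norm_exp]
    gcongr
    refine (Complex.re_le_norm _).trans ?_
    rw [norm_mul, norm_neg, Complex.norm_real, Real.norm_eq_abs]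
    gcongr
    have h1 := norm_le_norm_add_norm_sub' w z
    have h2 := mem_ball_iff_norm.1 hw
    linarith
  · exact Continuous.intervalIntegrable (by fun_prop) _ _
  · refine Filter.Eventually.of_forall fun θ _ w _ => ?_
    have := (((hasDerivAt_id w).neg.mul_const (g θ : ℂ)).cexp).mul_const (h θ)
    refine this.congr_deriv ?_
    simp only [id, Pi.neg_apply]
    ring

theorem iteratedDeriv_integral_mul_exp {g : ℝ → ℝ} {h : ℝ → ℂ} (hg : Continuous g)
    (hh : Continuous h) (a b : ℝ) (j : ℕ) (z : ℂ) :
    iteratedDeriv j (fun z : ℂ => ∫ θ in a..b, Complex.exp (-z * (g θ : ℂ)) * h θ) z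
      = ∫ θ in a..b, Complex.exp (-z * (g θ : ℂ)) * ((-(g θ : ℂ)) ^ j * h θ) := by
  have hgc : Continuous fun θ => (g θ : ℂ) := Complex.continuous_ofReal.comp hg
  induction j generalizing z with
  | zero => simp
  | succ j ih =>
    rw [iteratedDeriv_succ, funext ih, (hasDerivAt_integral_mul_exp hg
      (h := fun θ => (-(g θ : ℂ)) ^ j * h θ) (by fun_prop) a b z).deriv]
    congr 1 with θ
    ring

/-- A continuous function orthogonal on `[a, b]` to all powers of an injective continuous function
vanishes on `[a, b]`. -/
theorem eqOn_zero_of_integral_pow_mul_eq_zero {a b : ℝ} (hab : a < b) {g h : ℝ → ℝ}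
    (hg : Continuous g) (hginj : InjOn g (Icc a b)) (hh : Continuous h)
    (hint : ∀ j : ℕ, ∫ θ in a..b, g θ ^ j * h θ = 0) : EqOn h 0 (Icc a b) := by
  let G : C(Icc a b, ℝ) := ⟨fun x => g x, by fun_prop⟩
  let H : C(Icc a b, ℝ) := ⟨fun x => h x, by fun_prop⟩
  have hpoly (p : Polynomial ℝ) : ∫ θ in a..b, p.eval (g θ) * h θ = 0 := by
    induction p using Polynomial.induction_on' with
    | add p q hp hq =>
      simp only [Polynomial.eval_add, add_mul]
      rw [intervalIntegral.integral_add, hp, hq, add_zero] <;>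
        exact Continuous.intervalIntegrable (by fun_prop) _ _
    | monomial n c =>
      simp only [Polynomial.eval_monomial, mul_assoc, intervalIntegral.integral_const_mul, hint,
        mul_zero]
  have hsep : (Algebra.adjoin ℝ {G}).SeparatesPoints := by
    intro x y hxy
    refine ⟨G, ⟨G, Algebra.subset_adjoin rfl, rfl⟩, fun h => hxy ?_⟩
    exact Subtype.ext (hginj x.2 y.2 h)
  -- Stone–Weierstrass: the polynomials in `g` are dense.
  have hH : H ∈ (Algebra.adjoin ℝ {G}).topologicalClosure := by
    rw [ContinuousMap.subalgebra_topologicalClosure_eq_top_of_separatesPoints _ hsep]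
    trivial
  have hsq : ∫ θ in a..b, h θ * h θ = 0 := by
    by_contra hne
    obtain ⟨C, hC0, hC⟩ : ∃ C : ℝ, 0 < C ∧ ∀ θ ∈ Icc a b, ‖h θ‖ ≤ C := by
      obtain ⟨C, hC⟩ := isCompact_Icc.exists_bound_of_continuousOn (hh.continuousOn (s := Icc a b))
      exact ⟨max C 1, by positivity, fun θ hθ => (hC θ hθ).trans (le_max_left _ _)⟩
    set I := ∫ θ in a..b, h θ * h θ
    have hba : 0 < b - a := sub_pos.2 hab
    -- Chosen so that tolerance times sup bound times length is `|I| / 2`, which contradicts `I ≠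
    -- 0`.
    have hε : 0 < |I| / (2 * (C * (b - a))) := by positivity
    obtain ⟨P, hP, hPd⟩ := Metric.mem_closure_iff.1 hH _ hε
    rw [SetLike.mem_coe, Algebra.adjoin_singleton_eq_range_aeval] at hP
    obtain ⟨p, rfl⟩ := hP
    have heval (x : Icc a b) : Polynomial.aeval G p x = p.eval (g x) := by
      rw [Polynomial.aeval_continuousMap_apply]
      rfl
    have hle : |I| ≤ |I| / (2 * (C * (b - a))) * C * |b - a| := by
      have hI' : I = ∫ θ in a..b, (h θ - p.eval (g θ)) * h θ := by
        simp only [sub_mul]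
        rw [intervalIntegral.integral_sub, hpoly, sub_zero] <;>
          exact Continuous.intervalIntegrable (by fun_prop) _ _
      refine (congrArg norm hI').trans_le ?_
      refine intervalIntegral.norm_integral_le_of_norm_le_const fun θ hθ => ?_
      rw [uIoc_of_le hab.le] at hθ
      have hθ := Ioc_subset_Icc_self hθ
      rw [norm_mul]
      gcongr
      · have := (ContinuousMap.dist_apply_le_dist (⟨θ, hθ⟩ : Icc a b)).trans hPd.le
        change dist (h θ) (Polynomial.aeval G p ⟨θ, hθ⟩) ≤ _ at this
        rwa [heval, Real.dist_eq] at this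
      · exact hC θ hθ
    rw [abs_of_pos hba] at hle
    have : |I| / (2 * (C * (b - a))) * C * (b - a) = |I| / 2 := by field_simp
    have := abs_pos.2 hne
    linarith
  have hall := (intervalIntegral.integral_eq_zero_iff_of_le_of_nonneg_ae hab.le
    (f := fun θ => h θ * h θ) (Filter.Eventually.of_forall fun θ => mul_self_nonneg (h θ))
    (Continuous.intervalIntegrable (by fun_prop) _ _)).1 hsq
  -- The endpoints are included; the application evaluates at the left one.
  rw [Measure.restrict_congr_set Ioc_ae_eq_Icc] at hall
  intro θ hθ
  exact mul_self_eq_zero.1 (Measure.eqOn_Icc_of_ae_eq _ hab.ne hall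
    (hh.mul hh).continuousOn continuousOn_const hθ)

/-! ### The basis functions of the transformation `Φ_r` -/

theorem phiTransform_cos {r θ : ℝ} (hθ : θ ∈ Icc 0 Real.pi) :
    PhiTransform r (Real.cos θ) = jacobiDn (ellipticK (modulus r) / Real.pi * θ) (modulus r) := by
  rw [PhiTransform, Real.arccos_cos hθ.1 hθ.2, mul_div_right_comm]

theorem basisFunction_phiTransform (r : ℝ) (n : ℕ) :
    basisFunction (PhiTransform r) n = fun z => 1 / (Real.pi : ℂ) * ∫ θ in (0 : ℝ)..Real.pi,
      Complex.exp (-z * (jacobiDn (ellipticK (modulus r) / Real.pi * θ) (modulus r) : ℂ))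
        * (Real.cos (n * θ) : ℂ) := by
  ext z
  rw [basisFunction]
  congr 1
  refine intervalIntegral.integral_congr fun θ hθ => ?_
  rw [uIcc_of_le Real.pi_pos.le] at hθ
  simp only [phiTransform_cos hθ]

/-- Integration by parts against `cos (n θ)` for a function satisfying Neumann conditions
at `0` and `π`. -/
theorem integral_mul_cos_of_neumann {E E' E'' : ℝ → ℂ} (hE : ∀ θ, HasDerivAt E (E' θ) θ)
    (hE' : ∀ θ, HasDerivAt E' (E'' θ) θ) (hE'' : Continuous E'') (h0 : E' 0 = 0)
    (hpi : E' Real.pi = 0) (n : ℕ) :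
    ∫ θ in (0 : ℝ)..Real.pi, E'' θ * (Real.cos (n * θ) : ℂ)
      = -(n : ℂ) ^ 2 * ∫ θ in (0 : ℝ)..Real.pi, E θ * (Real.cos (n * θ) : ℂ) := by
  have hEc : Continuous E := continuous_iff_continuousAt.2 fun θ => (hE θ).continuousAt
  have hlin (θ : ℝ) : HasDerivAt (fun θ : ℝ => (n : ℝ) * θ) n θ := by
    simpa using (hasDerivAt_id θ).const_mul (n : ℝ)
  -- Both integrations by parts at once: the cross terms `n E' sin (n θ)` cancel.
  have hd (θ : ℝ) : HasDerivAt
      (fun θ => E' θ * (Real.cos (n * θ) : ℂ) + E θ * ((n : ℂ) * (Real.sin (n * θ) : ℂ)))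
      (E'' θ * (Real.cos (n * θ) : ℂ) + (n : ℂ) ^ 2 * (E θ * (Real.cos (n * θ) : ℂ))) θ := by
    have := ((hE' θ).mul (hlin θ).cos.ofReal_comp).add
      ((hE θ).mul ((hlin θ).sin.ofReal_comp.const_mul (n : ℂ)))
    refine this.congr_deriv ?_
    push_cast
    ring
  have hI := intervalIntegral.integral_eq_sub_of_hasDerivAt (a := 0) (b := Real.pi)
    (fun θ _ => hd θ) (Continuous.intervalIntegrable (by fun_prop) _ _)
  rw [intervalIntegral.integral_add (Continuous.intervalIntegrable (by fun_prop) _ _)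
    (Continuous.intervalIntegrable (by fun_prop) _ _), intervalIntegral.integral_const_mul] at hI
  simp only [h0, hpi, Real.sin_nat_mul_pi, mul_zero, Real.sin_zero, zero_mul, Complex.ofReal_zero,
    add_zero, sub_zero] at hI
  linear_combination hI

theorem differentiable_basisFunction_phiTransform {r : ℝ} (hk : modulus r ^ 2 < 1) (n : ℕ) :
    Differentiable ℂ (basisFunction (PhiTransform r) n) := by
  rw [basisFunction_phiTransform]
  intro z
  have hdn : Continuous fun v => jacobiDn v (modulus r) :=
    continuous_iff_continuousAt.2 fun v => (hasDerivAt_jacobiDn hk v).continuousAt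
  exact ((hasDerivAt_integral_mul_exp (hdn.comp (continuous_const_mul _))
    (h := fun θ => (Real.cos (n * θ) : ℂ)) (by fun_prop) _ _ z).const_mul _).differentiableAt

theorem iteratedDeriv_basisFunction_phiTransform {r : ℝ} (hk : modulus r ^ 2 < 1) (n j : ℕ)
    (z : ℂ) :
    iteratedDeriv j (basisFunction (PhiTransform r) n) z
      = 1 / (Real.pi : ℂ) * ∫ θ in (0 : ℝ)..Real.pi,
      Complex.exp (-z * (jacobiDn (ellipticK (modulus r) / Real.pi * θ) (modulus r) : ℂ))
        * ((-(jacobiDn (ellipticK (modulus r) / Real.pi * θ) (modulus r) : ℂ)) ^ j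
          * (Real.cos (n * θ) : ℂ)) := by
  have hdn : Continuous fun v => jacobiDn v (modulus r) :=
    continuous_iff_continuousAt.2 fun v => (hasDerivAt_jacobiDn hk v).continuousAt
  rw [basisFunction_phiTransform, iteratedDeriv_const_mul_field]
  congr 1
  exact iteratedDeriv_integral_mul_exp (hdn.comp (continuous_const_mul _))
    (h := fun θ => (Real.cos (n * θ) : ℂ)) (by fun_prop) _ _ j z

theorem exists_basisFunction_phiTransform_ne_zero {r : ℝ} (hk0 : modulus r ≠ 0)
    (hk : modulus r ^ 2 < 1) (n : ℕ) : ∃ z, basisFunction (PhiTransform r) n z ≠ 0 := by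
  by_contra! hz
  have hdn : Continuous fun v => jacobiDn v (modulus r) :=
    continuous_iff_continuousAt.2 fun v => (hasDerivAt_jacobiDn hk v).continuousAt
  have hpi := Real.pi_pos
  have hK := ellipticK_pos hk
  have hinj : InjOn (fun θ => jacobiDn (ellipticK (modulus r) / Real.pi * θ) (modulus r))
      (Icc 0 Real.pi) := by
    refine (jacobiDn_injOn hk0 hk).comp (mul_right_injective₀ (by positivity)).injOn ?_
    intro θ hθ
    refine ⟨mul_nonneg (by positivity) hθ.1, ?_⟩
    rw [div_mul_eq_mul_div, div_le_iff₀ hpi]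
    exact mul_le_mul_of_nonneg_left hθ.2 hK.le
  have hmom (j : ℕ) : ∫ θ in (0 : ℝ)..Real.pi,
      jacobiDn (ellipticK (modulus r) / Real.pi * θ) (modulus r) ^ j * Real.cos (n * θ) = 0 := by
    have h := iteratedDeriv_basisFunction_phiTransform hk n j 0
    rw [show basisFunction (PhiTransform r) n = fun _ => (0 : ℂ) from funext hz] at h
    have hconst : iteratedDeriv j (fun _ : ℂ => (0 : ℂ)) 0 = 0 := by simp
    have hpi' : (1 / (Real.pi : ℂ)) ≠ 0 := by simp [hpi.ne']
    have h := (mul_eq_zero.1 (h.symm.trans hconst)).resolve_left hpi'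
    have h' : (-1 : ℂ) ^ j * ∫ θ in (0 : ℝ)..Real.pi,
        ((jacobiDn (ellipticK (modulus r) / Real.pi * θ) (modulus r) ^ j * Real.cos (n * θ) : ℝ) : ℂ)
        = 0 := by
      rw [← intervalIntegral.integral_const_mul, ← h]
      congr 1 with θ
      rw [neg_zero, zero_mul, Complex.exp_zero, one_mul, neg_pow (_ : ℂ) j]
      push_cast
      ring
    have h' := (mul_eq_zero.1 h').resolve_left (pow_ne_zero _ (by simp))
    rw [intervalIntegral.integral_ofReal] at h'
    exact_mod_cast h'
  -- The contradiction is read off at `θ = 0`, where `cos (n θ) = 1`.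
  have := eqOn_zero_of_integral_pow_mul_eq_zero hpi (hdn.comp (continuous_const_mul _)) hinj
    (h := fun θ => Real.cos (n * θ)) (by fun_prop) hmom ⟨le_rfl, hpi.le⟩
  simp at this

theorem operatorD_basisFunction_phiTransform {r : ℝ} (hr0 : 0 < r) (hr1 : r < 1) (n : ℕ) (z : ℂ) :
    operatorD r (basisFunction (PhiTransform r) n) z =
      (((n : ℝ) ^ 2 * Real.pi ^ 2 / ellipticK (modulus r) ^ 2 : ℝ) : ℂ) *
        basisFunction (PhiTransform r) n z := by
  have hmod := modulus_sq hr0 hr1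
  have hk : modulus r ^ 2 < 1 := by rw [hmod]; nlinarith
  have hD := iteratedDeriv_basisFunction_phiTransform hk n
  have hB := congrFun (basisFunction_phiTransform r n) z
  have hpi := Real.pi_pos
  have hK := ellipticK_pos hk
  set k := modulus r
  set c : ℝ := ellipticK k / Real.pi with hc
  have hc0 : c ≠ 0 := by positivity
  let g : ℝ → ℝ := fun θ => jacobiDn (c * θ) k
  -- `S θ` is `dn'` at `c θ`, so `g' = c S`.
  let S : ℝ → ℝ := fun θ => -k ^ 2 * (Real.sin (jacobiAm (c * θ) k) * Real.cos (jacobiAm (c * θ) k))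
  have hlin (θ : ℝ) : HasDerivAt (fun θ : ℝ => c * θ) c θ := by
    simpa using (hasDerivAt_id θ).const_mul c
  have hg (θ : ℝ) : HasDerivAt g (S θ * c) θ := (hasDerivAt_jacobiDn hk (c * θ)).comp θ (hlin θ)
  have hS (θ : ℝ) : HasDerivAt S (((1 + r ^ 2) * g θ - 2 * g θ ^ 3) * c) θ := by
    refine ((hasDerivAt_sin_mul_cos_jacobiAm hk (c * θ)).comp θ (hlin θ)).congr_deriv ?_
    rw [hmod]
    ring
  have hSsq (θ : ℝ) : S θ ^ 2 = (1 - g θ ^ 2) * (g θ ^ 2 - r ^ 2) := by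
    have h1 := jacobiDn_sq hk (c * θ)
    have h2 := Real.sin_sq_add_cos_sq (jacobiAm (c * θ) k)
    have h3 : r ^ 2 = 1 - k ^ 2 := by linarith
    simp only [g, S, h1, h3]
    linear_combination (k ^ 4 * Real.sin (jacobiAm (c * θ) k) ^ 2) * h2
  have hgc : Continuous fun θ => (g θ : ℂ) := Complex.continuous_ofReal.comp
    (continuous_iff_continuousAt.2 fun θ => (hg θ).continuousAt)
  have hcos : Continuous fun θ : ℝ => (Real.cos (n * θ) : ℂ) := by fun_prop
  have hE (θ : ℝ) : HasDerivAt (fun θ => Complex.exp (-z * (g θ : ℂ)))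
      (Complex.exp (-z * (g θ : ℂ)) * (-z * ((S θ * c : ℝ) : ℂ))) θ :=
    ((hg θ).ofReal_comp.const_mul (-z)).cexp
  have hE' (θ : ℝ) : HasDerivAt
      (fun θ => Complex.exp (-z * (g θ : ℂ)) * (-z * ((S θ * c : ℝ) : ℂ)))
      (-(c : ℂ) ^ 2 * (Complex.exp (-z * (g θ : ℂ)) * (z ^ 2 * (g θ : ℂ) ^ 4 - 2 * z * (g θ : ℂ) ^ 3
        - (1 + (r : ℂ) ^ 2) * z ^ 2 * (g θ : ℂ) ^ 2 + (1 + (r : ℂ) ^ 2) * z * (g θ : ℂ)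
        + (r : ℂ) ^ 2 * z ^ 2))) θ := by
    have h := (hE θ).mul (((hS θ).mul_const c).ofReal_comp.const_mul (-z))
    refine h.congr_deriv ?_
    have h2 : (S θ : ℂ) ^ 2 = (1 - (g θ : ℂ) ^ 2) * ((g θ : ℂ) ^ 2 - (r : ℂ) ^ 2) := by
      exact_mod_cast hSsq θ
    push_cast
    linear_combination (Complex.exp (-z * (g θ : ℂ)) * z ^ 2 * (c : ℂ) ^ 2) * h2
  -- The Neumann conditions hold as `sin (am 0) = 0` and `cos (am K) = cos (π/2) = 0`.
  have hibp := integral_mul_cos_of_neumann hE hE' (by fun_prop)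
    (by simp [S, jacobiAm_zero hk])
    (by
      have : c * Real.pi = ellipticK k := by rw [hc]; field_simp
      simp [S, this, jacobiAm_ellipticK hk]) n
  have hbr : operatorD r (basisFunction (PhiTransform r) n) z = 1 / (Real.pi : ℂ) *
      ∫ θ in (0 : ℝ)..Real.pi, (Complex.exp (-z * (g θ : ℂ)) * (z ^ 2 * (g θ : ℂ) ^ 4
        - 2 * z * (g θ : ℂ) ^ 3 - (1 + (r : ℂ) ^ 2) * z ^ 2 * (g θ : ℂ) ^ 2
        + (1 + (r : ℂ) ^ 2) * z * (g θ : ℂ) + (r : ℂ) ^ 2 * z ^ 2)) * (Real.cos (n * θ) : ℂ) := by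
    have hi (j : ℕ) (a : ℂ) : IntervalIntegrable (fun θ => a * (Complex.exp (-z * (g θ : ℂ))
        * ((-(g θ : ℂ)) ^ j * (Real.cos (n * θ) : ℂ)))) volume 0 Real.pi :=
      Continuous.intervalIntegrable (by fun_prop) _ _
    -- Powers of `-g` match the form of the derivatives, whence the sign changes in odd degree.
    have hI : ∫ θ in (0 : ℝ)..Real.pi, (Complex.exp (-z * (g θ : ℂ)) * (z ^ 2 * (g θ : ℂ) ^ 4
        - 2 * z * (g θ : ℂ) ^ 3 - (1 + (r : ℂ) ^ 2) * z ^ 2 * (g θ : ℂ) ^ 2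
        + (1 + (r : ℂ) ^ 2) * z * (g θ : ℂ) + (r : ℂ) ^ 2 * z ^ 2)) * (Real.cos (n * θ) : ℂ)
        = ∫ θ in (0 : ℝ)..Real.pi,
          (z ^ 2 * (Complex.exp (-z * (g θ : ℂ)) * ((-(g θ : ℂ)) ^ 4 * (Real.cos (n * θ) : ℂ)))
          + 2 * z * (Complex.exp (-z * (g θ : ℂ)) * ((-(g θ : ℂ)) ^ 3 * (Real.cos (n * θ) : ℂ)))
          - (1 + (r : ℂ) ^ 2) * z ^ 2
            * (Complex.exp (-z * (g θ : ℂ)) * ((-(g θ : ℂ)) ^ 2 * (Real.cos (n * θ) : ℂ)))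
          - (1 + (r : ℂ) ^ 2) * z
            * (Complex.exp (-z * (g θ : ℂ)) * ((-(g θ : ℂ)) ^ 1 * (Real.cos (n * θ) : ℂ)))
          + (r : ℂ) ^ 2 * z ^ 2
            * (Complex.exp (-z * (g θ : ℂ)) * ((-(g θ : ℂ)) ^ 0 * (Real.cos (n * θ) : ℂ)))) := by
      congr 1 with θ
      ring
    rw [hI, intervalIntegral.integral_add ((((hi 4 _).add (hi 3 _)).sub (hi 2 _)).sub (hi 1 _))
        (hi 0 _),
      intervalIntegral.integral_sub (((hi 4 _).add (hi 3 _)).sub (hi 2 _)) (hi 1 _),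
      intervalIntegral.integral_sub ((hi 4 _).add (hi 3 _)) (hi 2 _),
      intervalIntegral.integral_add (hi 4 _) (hi 3 _)]
    simp only [intervalIntegral.integral_const_mul]
    have h0 := hD 0 z
    have h1 := hD 1 z
    rw [iteratedDeriv_zero] at h0
    rw [iteratedDeriv_one] at h1
    rw [operatorD, hD 4 z, hD 3 z, hD 2 z, h1, h0]
    ring
  simp only [mul_assoc (-(c : ℂ) ^ 2), intervalIntegral.integral_const_mul] at hibp
  have hcK : (((n : ℝ) ^ 2 * Real.pi ^ 2 / ellipticK k ^ 2 : ℝ) : ℂ) = (n : ℂ) ^ 2 / (c : ℂ) ^ 2 := by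
    rw [hc]
    push_cast
    rw [div_pow, div_div_eq_mul_div]
  have hcc : (c : ℂ) ≠ 0 := by exact_mod_cast hc0
  rw [hbr, hB, hcK]
  refine mul_left_cancel₀ (pow_ne_zero 2 hcc) ?_
  rw [← mul_assoc, ← mul_assoc, mul_div_cancel₀ _ (pow_ne_zero 2 hcc)]
  linear_combination (-(1 / (Real.pi : ℂ))) * hibp

theorem mainTheorem5 (r : ℝ) (hr0 : 0 < r) (hr1 : r < 1) :
    (∀ (f : ℂ → ℂ) (z : ℂ), AnalyticAt ℂ f z → operatorD r f z = operatorDFactored r f z) ∧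
    ∀ n : ℕ,
      Differentiable ℂ (basisFunction (PhiTransform r) n) ∧
      (∃ z : ℂ, basisFunction (PhiTransform r) n z ≠ 0) ∧
      ∀ z : ℂ,
        operatorD r (basisFunction (PhiTransform r) n) z =
          (((n : ℝ) ^ 2 * Real.pi ^ 2 / ellipticK (modulus r) ^ 2 : ℝ) : ℂ) *
            basisFunction (PhiTransform r) n z := by
  have hmod := modulus_sq hr0 hr1
  have hk : modulus r ^ 2 < 1 := by rw [hmod]; nlinarith
  have hk0 : modulus r ≠ 0 := by
    intro h
    rw [h] at hmod
    nlinarith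
  exact ⟨fun f z hf => operatorD_eq_operatorDFactored r hf, fun n =>
    ⟨differentiable_basisFunction_phiTransform hk n,
      exists_basisFunction_phiTransform_ne_zero hk0 hk n,
      operatorD_basisFunction_phiTransform hr0 hr1 n⟩⟩
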